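/- For a matrix $A\in\mathbb R^{n\times d}$ let $$\mathrm{OPT}_k(A)=\min_{X\in\mathcal X,\ D\in\mathbb R^{k\times d}}\|XD-A\|_F^2$$ be its optimal $k$-means cost, where $\mathcal X$ is the set of matrices $X\in\mathbb R^{n\times k}$ all of whose rows are standard basis vectors. A turnstile stream is a finite sequence of updates $A_{i,j}\leftarrow A_{i,j}+\Delta$ with $\Delta\in\mathbb R$, applied to a matrix $A\in\mathbb R^{n\times d}$ that is initially $0$; it presents the resulting matrix $A$. A randomized streaming algorithm using $s$ bits of space keeps a string of $s$ bits between consecutive updates; the new string may depend arbitrarily on the old one, on the update, on the number of the pass and the position in it, and on random coins, which are not charged for. It may also change its memory at the end of a pass, and its output is a function of the final memory and the coins. **Theorem.** Let $k=2$ and $d=1$. For every number of passes $r$ there are a constant $\gamma>0$ and an integer $N$ such that the following holds for every $n\ge N$. Let $\mathcal T$ be any class of turnstile streams presenting $n\times 1$ matrices that contains all streams of at most $2n$ updates with $\Delta\in\{-1,0,1\}$ (for example, the class of all turnstile streams). If a randomized streaming algorithm makes $r$ passes over its input stream and, for every stream in $\mathcal T$, outputs with probability at least $2/3$ a number $c\ge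 0$ satisfying $$c\le \mathrm{OPT}_2(A)\le 2c,$$ where $A$ is the matrix presented by the stream, then it uses at least $\gamma n$ bits of space. In short, estimating the optimal $2$-means cost in dimension $1$ within a factor $2$ in a constant number of passes over a turnstile stream requires $\Omega(n)$ bits of space. -/

import Mathlib

/-! ### The `k`-means objective in matrix form -/

/-- The set of `n × k` real matrices all of whose rows are standard basis vectors. -/
def assignmentMatrices (n k : ℕ) : Set (Matrix (Fin n) (Fin k) ℝ) :=
  {X | ∀ i, ∃ j, X i = Pi.single j 1}

section Cost

attribute [local instance] Matrix.frobeniusNormedAddCommGroup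

/-- All values `‖X D - A‖_F ^ 2` of the `k`-means objective of `A`, where `X` is an assignment
matrix and the `k` rows of `D` are the centers. -/
def kMeansValues {n d : ℕ} (k : ℕ) (A : Matrix (Fin n) (Fin d) ℝ) : Set ℝ :=
  {v | ∃ X ∈ assignmentMatrices n k, ∃ D : Matrix (Fin k) (Fin d) ℝ, v = ‖X * D - A‖ ^ 2}

end Cost

/-- The optimal `k`-means cost of `A`, that is, the minimum of `‖X D - A‖_F ^ 2`.  For `1 ≤ k` the
set of values is nonempty and bounded below by `0`, so that the infimum is not a junk value. -/
noncomputable def optCost {n d : ℕ} (k : ℕ) (A : Matrix (Fin n) (Fin d) ℝ) : ℝ :=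
  sInf (kMeansValues k A)

/-! ### Turnstile streams -/

/-- The entrywise update `A row col ← A row col + delta`. -/
structure Update (n d : ℕ) where
  row : Fin n
  col : Fin d
  delta : ℝ

/-- A turnstile stream: a finite sequence of entrywise updates. -/
abbrev TurnstileStream (n d : ℕ) : Type := List (Update n d)

/-- The matrix presented by a stream: it starts at `0` and receives the updates in turn. -/
def streamMatrix {n d : ℕ} (σ : TurnstileStream n d) : Matrix (Fin n) (Fin d) ℝ :=
  σ.foldl (fun A u => A + Matrix.single u.row u.col u.delta) 0

/-- The streams of at most `2 n` updates, each of which changes an entry by `-1`, `0` or `1`. -/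
def unitStreams (n d : ℕ) : Set (TurnstileStream n d) :=
  {σ | σ.length ≤ 2 * n ∧ ∀ u ∈ σ, u.delta = -1 ∨ u.delta = 0 ∨ u.delta = 1}

/-! ### Randomized streaming algorithms with `s` bits of memory -/

/-- A randomized streaming algorithm for `n × d` matrices with `s` bits of memory.  The only thing
that is kept from one update to the next is a string of `s` bits.  The random seed `ω : Ω`, the
number of the current pass and the position in the pass are available for free (in particular the
algorithm may toss fresh coins at every step), and the computation performed on one update
is not restricted in any way. -/
structure StreamingAlgorithm (Ω : Type*) (n d s : ℕ) where
  /-- The initial memory. -/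
  init : Ω → (Fin s → Bool)
  /-- `step ω p t m u` is the memory after reading `u` as update number `t` of pass number `p`,
  where `m` is the memory before. -/
  step : Ω → ℕ → ℕ → (Fin s → Bool) → Update n d → (Fin s → Bool)
  /-- `endPass ω p m` is the memory at the end of pass number `p`, when the algorithm learns that
  the stream is over. -/
  endPass : Ω → ℕ → (Fin s → Bool) → (Fin s → Bool)
  /-- The number that is output after the last pass. -/
  output : Ω → (Fin s → Bool) → ℝ

namespace StreamingAlgorithm

variable {Ω : Type*} {n d s : ℕ}

/-- The memory after reading the updates in the list, where `p` is the number of the pass, `t` the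
position of the first of these updates, and `m` the memory before. -/
def readFrom (alg : StreamingAlgorithm Ω n d s) (ω : Ω) (p : ℕ) :
    ℕ → (Fin s → Bool) → TurnstileStream n d → (Fin s → Bool)
  | _, m, [] => m
  | t, m, u :: σ => readFrom alg ω p (t + 1) (alg.step ω p t m u) σ

/-- The memory after a given number of passes over the stream `σ`. -/
def memoryAfter (alg : StreamingAlgorithm Ω n d s) (ω : Ω) (σ : TurnstileStream n d) :
    ℕ → (Fin s → Bool)
  | 0 => alg.init ω
  | p + 1 => alg.endPass ω p (alg.readFrom ω p 0 (memoryAfter alg ω σ p) σ)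

/-- The output after `r` passes over the stream `σ`. -/
def run (alg : StreamingAlgorithm Ω n d s) (r : ℕ) (σ : TurnstileStream n d) (ω : Ω) : ℝ :=
  alg.output ω (alg.memoryAfter ω σ r)

/-- On every stream of the class `T`, with probability at least `2 / 3`, the algorithm outputs after
`r` passes a number `c ≥ 0` with `c ≤ OPT ≤ 2 c`, where `OPT` is the optimal `k`-means cost of the
matrix presented by the stream.  (The event of success is only asked to contain a measurable
event of probability at least `2 / 3`.) -/
def EstimatesCost [MeasurableSpace Ω] (alg : StreamingAlgorithm Ω n d s)
    (μ : MeasureTheory.Measure Ω) (k r : ℕ) (T : Set (TurnstileStream n d)) : Prop :=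
  ∀ σ ∈ T, ∃ E : Set Ω, MeasurableSet E ∧ 2 / 3 ≤ μ E ∧ ∀ ω ∈ E,
    0 ≤ alg.run r σ ω ∧
    alg.run r σ ω ≤ optCost k (streamMatrix σ) ∧
    optCost k (streamMatrix σ) ≤ 2 * alg.run r σ ω

end StreamingAlgorithm

/-! The proof reduces from set disjointness. Row 0 stays `0`, row 1 becomes `1`, and the bits of `x`
and then of `y` are added to the remaining rows. If `x` and `y` are disjoint, all entries are `0` or
`1` and the cost is `0`; otherwise `0`, `1`, `2` all occur and the cost is positive. A factor-2
estimate must recognise cost `0`. For a fixed seed, the `2r` memory states seen at the middle and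
the end of each pass form a transcript, and each transcript corresponds to a rectangle of pairs `(x,
y)` (`transcript_eq_iff`).

It remains to show that disjointness on `m` bits needs `exp(Ω(m))` transcripts
(`card_le_log_card_transcripts`). Take a random set `d`, with `x` uniform on subsets of `d` and `y`
uniform on subsets of its complement. By `level_one_inequality` and the entropy bound, the
first-level Fourier weights, summed over coordinates and transcripts, are at most `2 log |T|`. The
weight at `i` dominates the squared Hellinger change of the transcript when one player's bit `i` is
switched on; averaging over `d` and `flipBit i d` covers both players. By `cut_and_paste`, the
transcripts for bits `(0,0)` and `(1,1)` at `i` are then close, yet a correct protocol separates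
them with advantage `1/3` for every `i`. -/

open scoped BigOperators

/-! ### Fourier weight on the first level -/

/-- The character `±1` of a bit. -/
def bitSign (b : Bool) : ℝ := if b then -1 else 1

/-- Negation of the bit number `i`. -/
def flipBit {ι : Type*} [DecidableEq ι] (i : ι) (x : ι → Bool) : ι → Bool :=
  Function.update x i (!x i)

theorem flipBit_involutive {ι : Type*} [DecidableEq ι] (i : ι) :
    Function.Involutive (flipBit i) := by
  intro x
  simp [flipBit]

theorem expect_flipBit {ι : Type*} [Fintype ι] [DecidableEq ι] (i : ι) (F : (ι → Bool) → ℝ) :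
    𝔼 x, F (flipBit i x) = 𝔼 x, F x :=
  Fintype.expect_equiv (flipBit_involutive i).toPerm _ _ (fun _ => rfl)

theorem expect_eq_average_update {ι : Type*} [Fintype ι] [DecidableEq ι] (i : ι)
    (F : (ι → Bool) → ℝ) :
    𝔼 x, F x = (𝔼 x, F (Function.update x i false) + 𝔼 x, F (Function.update x i true)) / 2 := by
  have h : 𝔼 x, F (Function.update x i false) + 𝔼 x, F (Function.update x i true)
      = 𝔼 x, F x + 𝔼 x, F (flipBit i x) := by
    rw [← Finset.expect_add_distrib, ← Finset.expect_add_distrib]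
    refine Finset.expect_congr rfl fun x _ => ?_
    cases hx : x i
    · have h1 : Function.update x i false = x := by rw [← hx, Function.update_eq_self]
      simp [flipBit, hx, h1]
    · have h1 : Function.update x i true = x := by rw [← hx, Function.update_eq_self]
      simp [flipBit, hx, h1, add_comm]
  rw [h, expect_flipBit]
  ring

/-- Independence turns the mean into a product of `cosh (a i)`, each at most `exp (a i ^ 2 / 2)`. -/
theorem expect_exp_sum_bitSign_le {ι : Type*} [Fintype ι] [DecidableEq ι] (a : ι → ℝ) :
    𝔼 x : ι → Bool, Real.exp (∑ i, a i * bitSign (x i)) ≤ Real.exp ((∑ i, a i ^ 2) / 2) := by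
  have h : 𝔼 x : ι → Bool, Real.exp (∑ i, a i * bitSign (x i)) = ∏ i, Real.cosh (a i) := by
    rw [Fintype.expect_eq_sum_div_card]
    simp only [Real.exp_sum]
    rw [← Fintype.prod_sum (fun i b => Real.exp (a i * bitSign b))]
    simp only [Fintype.sum_bool, Fintype.card_pi, Fintype.card_bool, Nat.cast_prod]
    rw [← Finset.prod_div_distrib]
    refine Finset.prod_congr rfl fun i _ => ?_
    simp [bitSign, Real.cosh_eq, add_comm]
  rw [h, Finset.sum_div, Real.exp_sum]
  exact Finset.prod_le_prod (fun i _ => (Real.cosh_pos _).le) fun i _ => Real.cosh_le_exp_half_sq _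

/-- The level-one inequality for functions on the cube with values in `[0, 1]`. -/
theorem level_one_inequality {ι : Type*} [Fintype ι] [DecidableEq ι] (f : (ι → Bool) → ℝ)
    (h0 : ∀ x, 0 ≤ f x) (h1 : ∀ x, f x ≤ 1) :
    ∑ i, (𝔼 x, f x * bitSign (x i)) ^ 2 / 𝔼 x, f x
      ≤ 2 * (𝔼 x, f x) * (-Real.log (𝔼 x, f x)) := by
  set A := 𝔼 x, f x with hA
  have hA0 : 0 ≤ A := Finset.expect_nonneg fun x _ => h0 x
  rcases hA0.eq_or_lt with hz | hpos
  · simp [← hz]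
  -- With this choice the linear form `∑ a i χ i` has mean `c` under the density `f / A`. Jensen
  -- bounds its exponential moment below by `A * exp c`, the subgaussian estimate bounds it above by
  -- `exp (c / 2)`; hence `c ≤ -2 log A`.
  set a : ι → ℝ := fun i => (𝔼 x, f x * bitSign (x i)) / A with ha
  set c := ∑ i, a i ^ 2 with hc
  have hfa : ∀ i, 𝔼 x, f x * bitSign (x i) = A * a i := fun i => by
    simp only [ha]; field_simp
  have hlin : 𝔼 x, f x * (∑ i, a i * bitSign (x i)) = A * c := by
    simp only [Finset.mul_sum]
    rw [Finset.expect_sum_comm, hc, Finset.mul_sum]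
    refine Finset.sum_congr rfl fun i _ => ?_
    rw [show A * a i ^ 2 = a i * (A * a i) by ring, ← hfa i, Finset.mul_expect]
    exact Finset.expect_congr rfl fun x _ => by ring
  have hlow : A * Real.exp c ≤ 𝔼 x, f x * Real.exp (∑ i, a i * bitSign (x i)) := by
    have : A * Real.exp c
        = 𝔼 x, f x * (Real.exp c * (1 + (∑ i, a i * bitSign (x i)) - c)) := by
      have e : ∀ x, f x * (Real.exp c * (1 + (∑ i, a i * bitSign (x i)) - c))
          = Real.exp c * (1 - c) * f x + Real.exp c * (f x * ∑ i, a i * bitSign (x i)) := by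
        intro x; ring
      simp only [e]
      rw [Finset.expect_add_distrib, ← Finset.mul_expect, ← Finset.mul_expect, hlin, ← hA]
      ring
    rw [this]
    refine Finset.expect_le_expect fun x _ => mul_le_mul_of_nonneg_left ?_ (h0 x)
    -- Jensen in tangent-line form, at the mean `c`.
    have h := Real.add_one_le_exp ((∑ i, a i * bitSign (x i)) - c)
    calc Real.exp c * (1 + (∑ i, a i * bitSign (x i)) - c)
        ≤ Real.exp c * Real.exp ((∑ i, a i * bitSign (x i)) - c) :=
          mul_le_mul_of_nonneg_left (by linarith) (Real.exp_pos _).le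
      _ = _ := by rw [← Real.exp_add]; congr 1; ring
  have hup : 𝔼 x, f x * Real.exp (∑ i, a i * bitSign (x i)) ≤ Real.exp (c / 2) :=
    (Finset.expect_le_expect fun x _ =>
      mul_le_of_le_one_left (Real.exp_pos _).le (h1 x)).trans (expect_exp_sum_bitSign_le a)
  have hlog := Real.log_le_log (by positivity) (hlow.trans hup)
  rw [Real.log_mul hpos.ne' (Real.exp_pos _).ne', Real.log_exp, Real.log_exp] at hlog
  have hs : ∑ i, (𝔼 x, f x * bitSign (x i)) ^ 2 / A = A * c := by
    rw [hc, Finset.mul_sum]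
    refine Finset.sum_congr rfl fun i _ => ?_
    rw [hfa i]; field_simp
  rw [hs]
  nlinarith

/-- The entropy of a probability vector is at most the logarithm of its length. -/
theorem sum_mul_neg_log_le_log_card {T : Type*} [Fintype T] (p : T → ℝ) (h0 : ∀ τ, 0 ≤ p τ)
    (h1 : ∑ τ, p τ = 1) : ∑ τ, p τ * (-Real.log (p τ)) ≤ Real.log (Fintype.card T) := by
  have hne : Nonempty T := by
    by_contra h
    rw [not_nonempty_iff] at h
    simp at h1
  set M : ℝ := (Fintype.card T : ℝ) with hM
  have hMpos : 0 < M := by rw [hM]; exact_mod_cast Fintype.card_pos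
  -- Gibbs' inequality against the uniform distribution: `log t ≤ t - 1` at `t = 1 / (p τ * M)`.
  have key : ∀ τ, p τ * (-Real.log (p τ)) ≤ p τ * Real.log M + (M⁻¹ - p τ) := by
    intro τ
    rcases (h0 τ).eq_or_lt with hz | hpos
    · simp [← hz, hMpos.le]
    · have h := Real.log_le_sub_one_of_pos (show 0 < (p τ * M)⁻¹ by positivity)
      rw [Real.log_inv, Real.log_mul hpos.ne' hMpos.ne'] at h
      have h2 := mul_le_mul_of_nonneg_left h (h0 τ)
      have h3 : p τ * ((p τ * M)⁻¹ - 1) = M⁻¹ - p τ := by field_simp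
      rw [h3] at h2
      linarith
  calc ∑ τ, p τ * (-Real.log (p τ)) ≤ ∑ τ, (p τ * Real.log M + (M⁻¹ - p τ)) :=
        Finset.sum_le_sum fun τ _ => key τ
    _ = Real.log M := by
        rw [Finset.sum_add_distrib, ← Finset.sum_mul, Finset.sum_sub_distrib, h1]
        simp only [Finset.sum_const, Finset.card_univ, nsmul_eq_mul]
        rw [← hM, mul_inv_cancel₀ hMpos.ne']
        ring

/-! ### A Hellinger estimate for four transcript distributions -/

/-- Factor `x² - y²` and use `(x + y)² ≥ x² + y²`. With `x`, `y` square roots of masses, this passes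
from Fourier weight to Hellinger distance. -/
theorem sub_sq_le_sq_sub_sq_div (x y : ℝ) (hx : 0 ≤ x) (hy : 0 ≤ y) :
    (x - y) ^ 2 ≤ (x ^ 2 - y ^ 2) ^ 2 / (x ^ 2 + y ^ 2) := by
  rcases (show 0 ≤ x ^ 2 + y ^ 2 by positivity).eq_or_lt with h | h
  · have h1 : x = 0 := by nlinarith [sq_nonneg x, sq_nonneg y]
    have h2 : y = 0 := by nlinarith [sq_nonneg x, sq_nonneg y]
    simp [h1, h2]
  · rw [le_div_iff₀ h]
    have : (x ^ 2 - y ^ 2) ^ 2 - (x - y) ^ 2 * (x ^ 2 + y ^ 2) = (x - y) ^ 2 * (2 * (x * y)) := by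
      ring
    have h2 : 0 ≤ (x - y) ^ 2 * (2 * (x * y)) := by positivity
    linarith

/-- If `a u τ ^ 2 * b v τ ^ 2` is a probability distribution in `τ` for all bits `u` and `v`, then
the distributions for `(0, 0)` and `(1, 1)` are close as soon as those for `(0, 0)` and `(1, 0)`,
and for `(0, 0)` and `(0, 1)`, are close. -/
theorem cut_and_paste {T : Type*} [Fintype T] (a b : Bool → T → ℝ)
    (hab : ∀ u v, ∑ τ, a u τ ^ 2 * b v τ ^ 2 = 1) (S : Finset T) :
    ∑ τ ∈ S, (a false τ ^ 2 * b false τ ^ 2 - a true τ ^ 2 * b true τ ^ 2)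
      ≤ 12 * ∑ τ, (b false τ ^ 2 * (a false τ - a true τ) ^ 2
          + a false τ ^ 2 * (b false τ - b true τ) ^ 2) + 1 / 6 := by
  set p : T → ℝ := fun τ => a false τ * b false τ with hp
  set q : T → ℝ := fun τ => a true τ * b true τ with hq
  -- AM-GM on `p² - q² = (p - q)(p + q)`, weighted so that the second term sums to at most `4 / 24 =
  -- 1 / 6`, half of the advantage `1 / 3` to be contradicted.
  have h1 : ∑ τ ∈ S, (a false τ ^ 2 * b false τ ^ 2 - a true τ ^ 2 * b true τ ^ 2)
      ≤ ∑ τ, (6 * (p τ - q τ) ^ 2 + (p τ + q τ) ^ 2 / 24) := by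
    refine (Finset.sum_le_sum fun τ _ => ?_).trans
      (Finset.sum_le_sum_of_subset_of_nonneg (Finset.subset_univ S) fun τ _ _ => by positivity)
    simp only [hp, hq]
    nlinarith [sq_nonneg (12 * (a false τ * b false τ - a true τ * b true τ)
      - (a false τ * b false τ + a true τ * b true τ))]
  have h2 : ∑ τ, (p τ + q τ) ^ 2 ≤ 4 := by
    calc ∑ τ, (p τ + q τ) ^ 2
        ≤ ∑ τ, (2 * (a false τ ^ 2 * b false τ ^ 2) + 2 * (a true τ ^ 2 * b true τ ^ 2)) := by
          refine Finset.sum_le_sum fun τ _ => ?_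
          simp only [hp, hq]
          nlinarith [sq_nonneg (a false τ * b false τ - a true τ * b true τ)]
      _ = 4 := by
          rw [Finset.sum_add_distrib, ← Finset.mul_sum, ← Finset.mul_sum, hab, hab]
          norm_num
  -- The cut-and-paste identity: the pairs `(0,0), (1,1)` and `(0,1), (1,0)` have the same Hellinger
  -- affinity `∑ a₀b₀a₁b₁`.
  have h3 : ∑ τ, (p τ - q τ) ^ 2
      = ∑ τ, (a false τ * b true τ - a true τ * b false τ) ^ 2 := by
    have e : ∀ τ, (p τ - q τ) ^ 2 = (a false τ * b true τ - a true τ * b false τ) ^ 2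
        + (a false τ ^ 2 * b false τ ^ 2 + a true τ ^ 2 * b true τ ^ 2
        - a false τ ^ 2 * b true τ ^ 2 - a true τ ^ 2 * b false τ ^ 2) := by
      intro τ
      simp only [hp, hq]
      ring
    simp only [e]
    rw [Finset.sum_add_distrib, Finset.sum_sub_distrib, Finset.sum_sub_distrib,
      Finset.sum_add_distrib, hab, hab, hab, hab]
    ring
  -- Triangle inequality through `(0,0)`.
  have h4 : ∑ τ, (a false τ * b true τ - a true τ * b false τ) ^ 2
      ≤ 2 * ∑ τ, (b false τ ^ 2 * (a false τ - a true τ) ^ 2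
          + a false τ ^ 2 * (b false τ - b true τ) ^ 2) := by
    rw [Finset.mul_sum]
    refine Finset.sum_le_sum fun τ _ => ?_
    nlinarith [sq_nonneg (a false τ * (b true τ - b false τ) - b false τ * (a false τ - a true τ))]
  rw [Finset.sum_add_distrib, ← Finset.mul_sum, ← Finset.sum_div] at h1
  linarith

/-! ### Restricting inputs to disjoint supports -/

/-- The coordinatewise conjunction of two bit strings. -/
def maskBits {ι : Type*} (x d : ι → Bool) : ι → Bool := fun j => x j && d j

/-- The coordinatewise negation of a bit string. -/
def notBits {ι : Type*} (d : ι → Bool) : ι → Bool := fun j => !d j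

section Pinned

variable {ι : Type*} [DecidableEq ι]

theorem maskBits_update {d : ι → Bool} {i : ι} (h : d i = true) (x : ι → Bool) (u : Bool) :
    maskBits (Function.update x i u) d = Function.update (maskBits x d) i u := by
  funext j
  by_cases hj : j = i
  · subst hj; simp [maskBits, h]
  · simp [maskBits, hj]

theorem update_maskBits_false {d : ι → Bool} {i : ι} (h : d i = false) (x : ι → Bool) :
    Function.update (maskBits x d) i false = maskBits x d := by
  rw [Function.update_eq_self_iff]
  simp [maskBits, h]

theorem update_maskBits_flipBit (x d : ι → Bool) (i : ι) (u : Bool) :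
    Function.update (maskBits x (flipBit i d)) i u = Function.update (maskBits x d) i u := by
  funext j
  by_cases hj : j = i
  · subst hj; simp
  · simp [maskBits, flipBit, hj]

theorem notBits_flipBit (d : ι → Bool) (i : ι) : notBits (flipBit i d) = flipBit i (notBits d) := by
  funext j
  by_cases hj : j = i
  · subst hj; simp [notBits, flipBit]
  · simp [notBits, flipBit, hj]

variable [Fintype ι]

/-- The average of `f` over the strings supported in `d` with bit number `i` replaced by `u`. -/
noncomputable def pinnedMean (f : (ι → Bool) → ℝ) (d : ι → Bool) (i : ι) (u : Bool) : ℝ :=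
  𝔼 x, f (Function.update (maskBits x d) i u)

/-- The average of `f` over the strings supported in `d`. -/
noncomputable def maskedMean (f : (ι → Bool) → ℝ) (d : ι → Bool) : ℝ :=
  𝔼 x, f (maskBits x d)

/-- The first-level Fourier coefficients of `f` restricted to the strings supported in `d`. -/
noncomputable def maskedCoeff (f : (ι → Bool) → ℝ) (d : ι → Bool) (i : ι) : ℝ :=
  𝔼 x, f (maskBits x d) * bitSign (x i)

/-- Pinning overrides coordinate `i`, so whether `i` lies in `d` is irrelevant; hence `d` and its
flip describe the same four pinned distributions. -/
theorem pinnedMean_flipBit (f : (ι → Bool) → ℝ) (d : ι → Bool) (i : ι) (u : Bool) :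
    pinnedMean f (flipBit i d) i u = pinnedMean f d i u := by
  simp only [pinnedMean, update_maskBits_flipBit]

theorem maskedMean_of_true (f : (ι → Bool) → ℝ) {d : ι → Bool} {i : ι} (h : d i = true) :
    maskedMean f d = (pinnedMean f d i false + pinnedMean f d i true) / 2 := by
  rw [maskedMean, expect_eq_average_update i]
  simp only [maskBits_update h, pinnedMean]

theorem maskedCoeff_of_true (f : (ι → Bool) → ℝ) {d : ι → Bool} {i : ι} (h : d i = true) :
    maskedCoeff f d i = (pinnedMean f d i false - pinnedMean f d i true) / 2 := by
  rw [maskedCoeff, expect_eq_average_update i]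
  simp [maskBits_update h, pinnedMean, bitSign, Finset.expect_neg_distrib, sub_eq_add_neg]

theorem maskedMean_of_false (f : (ι → Bool) → ℝ) {d : ι → Bool} {i : ι} (h : d i = false) :
    maskedMean f d = pinnedMean f d i false := by
  simp only [maskedMean, pinnedMean, update_maskBits_false h]

theorem pinnedMean_nonneg {f : (ι → Bool) → ℝ} (hf : ∀ x, 0 ≤ f x) (d : ι → Bool) (i : ι)
    (u : Bool) : 0 ≤ pinnedMean f d i u :=
  Finset.expect_nonneg fun _ _ => hf _

theorem maskedMean_nonneg {f : (ι → Bool) → ℝ} (hf : ∀ x, 0 ≤ f x) (d : ι → Bool) :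
    0 ≤ maskedMean f d :=
  Finset.expect_nonneg fun _ _ => hf _

/-- The normalized first-level weight, at coordinate `i`, of the product of `f` restricted to the
strings supported in `d` and `g` restricted to the strings supported off `d`. -/
noncomputable def levelOneWeight (f g : (ι → Bool) → ℝ) (d : ι → Bool) (i : ι) : ℝ :=
  maskedMean g (notBits d) * (maskedCoeff f d i ^ 2 / maskedMean f d)
    + maskedMean f d * (maskedCoeff g (notBits d) i ^ 2 / maskedMean g (notBits d))

theorem sum_levelOneWeight_le {f g : (ι → Bool) → ℝ} (f0 : ∀ x, 0 ≤ f x) (f1 : ∀ x, f x ≤ 1)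
    (g0 : ∀ x, 0 ≤ g x) (g1 : ∀ x, g x ≤ 1) (d : ι → Bool) :
    ∑ i, levelOneWeight f g d i
      ≤ 2 * (maskedMean f d * maskedMean g (notBits d)
        * (-Real.log (maskedMean f d * maskedMean g (notBits d)))) := by
  have hf := level_one_inequality (fun x => f (maskBits x d)) (fun _ => f0 _) (fun _ => f1 _)
  have hg := level_one_inequality (fun x => g (maskBits x (notBits d))) (fun _ => g0 _)
    (fun _ => g1 _)
  have A0 := maskedMean_nonneg f0 d
  have B0 := maskedMean_nonneg g0 (notBits d)
  simp only [levelOneWeight]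
  rw [Finset.sum_add_distrib, ← Finset.mul_sum, ← Finset.mul_sum]
  change ∑ i, maskedCoeff f d i ^ 2 / maskedMean f d
    ≤ 2 * maskedMean f d * (-Real.log (maskedMean f d)) at hf
  change ∑ i, maskedCoeff g (notBits d) i ^ 2 / maskedMean g (notBits d)
    ≤ 2 * maskedMean g (notBits d) * (-Real.log (maskedMean g (notBits d))) at hg
  refine (add_le_add (mul_le_mul_of_nonneg_left hf B0) (mul_le_mul_of_nonneg_left hg A0)).trans ?_
  generalize maskedMean f d = A at *
  generalize maskedMean g (notBits d) = B at *
  rcases A0.eq_or_lt with h | hA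
  · simp [← h]
  rcases B0.eq_or_lt with h | hB
  · simp [← h]
  rw [Real.log_mul hA.ne' hB.ne']
  apply le_of_eq
  ring

theorem half_sq_sqrt_sub_sqrt_le {f : (ι → Bool) → ℝ} (f0 : ∀ x, 0 ≤ f x) {d : ι → Bool} {i : ι}
    (h : d i = true) :
    (√(pinnedMean f d i false) - √(pinnedMean f d i true)) ^ 2 / 2
      ≤ maskedCoeff f d i ^ 2 / maskedMean f d := by
  have h0 := pinnedMean_nonneg f0 d i false
  have h1 := pinnedMean_nonneg f0 d i true
  have key := sub_sq_le_sq_sub_sq_div _ _ (Real.sqrt_nonneg (pinnedMean f d i false))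
    (Real.sqrt_nonneg (pinnedMean f d i true))
  rw [Real.sq_sqrt h0, Real.sq_sqrt h1] at key
  rw [maskedCoeff_of_true f h, maskedMean_of_true f h]
  generalize pinnedMean f d i false = p at *
  generalize pinnedMean f d i true = q at *
  have e : ((p - q) / 2) ^ 2 / ((p + q) / 2) = (p - q) ^ 2 / (p + q) / 2 := by
    rcases (add_nonneg h0 h1).eq_or_lt with hz | hz
    · simp [← hz]
    · field_simp
  rw [e]
  linarith

/-- Since `i` lies in `d`, the second player's bit `i` is already `0`, so the mean of `g` is its
pinned mean; the nonnegative `g` term of the weight is dropped. -/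
theorem le_levelOneWeight_of_true {f g : (ι → Bool) → ℝ} (f0 : ∀ x, 0 ≤ f x) (g0 : ∀ x, 0 ≤ g x)
    {d : ι → Bool} {i : ι} (h : d i = true) :
    pinnedMean g (notBits d) i false
      * ((√(pinnedMean f d i false) - √(pinnedMean f d i true)) ^ 2 / 2)
      ≤ levelOneWeight f g d i := by
  have h' : notBits d i = false := by simp [notBits, h]
  rw [levelOneWeight, ← maskedMean_of_false g h']
  have A0 := maskedMean_nonneg f0 d
  have B0 := maskedMean_nonneg g0 (notBits d)
  have h2 := mul_le_mul_of_nonneg_left (half_sq_sqrt_sub_sqrt_le f0 h) B0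
  have h3 : 0 ≤ maskedMean f d
    * (maskedCoeff g (notBits d) i ^ 2 / maskedMean g (notBits d)) := by positivity
  linarith

theorem levelOneWeight_notBits (f g : (ι → Bool) → ℝ) (d : ι → Bool) (i : ι) :
    levelOneWeight g f (notBits d) i = levelOneWeight f g d i := by
  have h : notBits (notBits d) = d := by funext j; simp [notBits]
  rw [levelOneWeight, levelOneWeight, h, add_comm]

theorem le_levelOneWeight_of_false {f g : (ι → Bool) → ℝ} (f0 : ∀ x, 0 ≤ f x) (g0 : ∀ x, 0 ≤ g x)
    {d : ι → Bool} {i : ι} (h : d i = false) :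
    pinnedMean f d i false
      * ((√(pinnedMean g (notBits d) i false) - √(pinnedMean g (notBits d) i true)) ^ 2 / 2)
      ≤ levelOneWeight f g d i := by
  have h' : notBits d i = true := by simp [notBits, h]
  have hd : notBits (notBits d) = d := by funext j; simp [notBits]
  have := le_levelOneWeight_of_true g0 f0 h'
  rwa [hd, levelOneWeight_notBits] at this

/-- Each of `d` and `flipBit i d` leaves bit `i` free for exactly one player, so together they
control both switches. -/
theorem le_levelOneWeight_add_flipBit {f g : (ι → Bool) → ℝ} (f0 : ∀ x, 0 ≤ f x)
    (g0 : ∀ x, 0 ≤ g x) (d : ι → Bool) (i : ι) :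
    pinnedMean g (notBits d) i false
        * (√(pinnedMean f d i false) - √(pinnedMean f d i true)) ^ 2
      + pinnedMean f d i false
        * (√(pinnedMean g (notBits d) i false) - √(pinnedMean g (notBits d) i true)) ^ 2
      ≤ 2 * (levelOneWeight f g d i + levelOneWeight f g (flipBit i d) i) := by
  cases h : d i
  · have h' : flipBit i d i = true := by simp [flipBit, h]
    have e1 := le_levelOneWeight_of_false f0 g0 h
    have e2 := le_levelOneWeight_of_true f0 g0 h'
    simp only [notBits_flipBit, pinnedMean_flipBit] at e2
    linarith
  · have h' : flipBit i d i = false := by simp [flipBit, h]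
    have e1 := le_levelOneWeight_of_true f0 g0 h
    have e2 := le_levelOneWeight_of_false f0 g0 h'
    simp only [notBits_flipBit, pinnedMean_flipBit] at e2
    linarith

end Pinned

/-! ### Set disjointness -/

section Disjointness

variable {ι T : Type*} [Fintype ι] [DecidableEq ι] [Fintype T]

theorem sum_mul_expect_eq_one {f g : T → (ι → Bool) → ℝ} (hfg : ∀ x y, ∑ τ, f τ x * g τ y = 1)
    (P Q : (ι → Bool) → (ι → Bool)) :
    ∑ τ, (𝔼 x, f τ (P x)) * (𝔼 y, g τ (Q y)) = 1 := by
  simp only [Fintype.expect_mul_expect]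
  simp only [← Finset.expect_sum_comm, hfg]
  simp

theorem sum_pinnedMean_sub_le {f g : T → (ι → Bool) → ℝ} (f0 : ∀ τ x, 0 ≤ f τ x)
    (g0 : ∀ τ x, 0 ≤ g τ x) (hfg : ∀ x y, ∑ τ, f τ x * g τ y = 1) (S : Finset T)
    (d : ι → Bool) (i : ι) :
    ∑ τ ∈ S, (pinnedMean (f τ) d i false * pinnedMean (g τ) (notBits d) i false
        - pinnedMean (f τ) d i true * pinnedMean (g τ) (notBits d) i true)
      ≤ 24 * ∑ τ, (levelOneWeight (f τ) (g τ) d i + levelOneWeight (f τ) (g τ) (flipBit i d) i)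
        + 1 / 6 := by
  have hf : ∀ u τ, √(pinnedMean (f τ) d i u) ^ 2 = pinnedMean (f τ) d i u :=
    fun u τ => Real.sq_sqrt (pinnedMean_nonneg (f0 τ) d i u)
  have hg : ∀ u τ, √(pinnedMean (g τ) (notBits d) i u) ^ 2 = pinnedMean (g τ) (notBits d) i u :=
    fun u τ => Real.sq_sqrt (pinnedMean_nonneg (g0 τ) _ i u)
  have key := cut_and_paste (fun u τ => √(pinnedMean (f τ) d i u))
    (fun u τ => √(pinnedMean (g τ) (notBits d) i u))
    (by
      intro u v
      simp only [hf, hg]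
      exact sum_mul_expect_eq_one hfg _ _) S
  simp only [hf, hg] at key
  refine key.trans ?_
  have h := Finset.sum_le_sum fun τ (_ : τ ∈ Finset.univ) =>
    le_levelOneWeight_add_flipBit (f0 τ) (g0 τ) d i
  rw [← Finset.mul_sum] at h
  linarith

/-- A partition of the input pairs into few weighted rectangles cannot tell disjoint pairs from
pairs with one common element: the average advantage is bounded by the logarithm of the number of
rectangles. -/
theorem disjointness_advantage_le {f g : T → (ι → Bool) → ℝ} (f0 : ∀ τ x, 0 ≤ f τ x)
    (f1 : ∀ τ x, f τ x ≤ 1) (g0 : ∀ τ x, 0 ≤ g τ x) (g1 : ∀ τ x, g τ x ≤ 1)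
    (hfg : ∀ x y, ∑ τ, f τ x * g τ y = 1) (S : Finset T) :
    ∑ i, 𝔼 d, 𝔼 x, 𝔼 y, ∑ τ ∈ S,
        (f τ (Function.update (maskBits x d) i false)
            * g τ (Function.update (maskBits y (notBits d)) i false)
          - f τ (Function.update (maskBits x d) i true)
            * g τ (Function.update (maskBits y (notBits d)) i true))
      ≤ 96 * Real.log (Fintype.card T) + Fintype.card ι / 6 := by
  have e : ∀ (i : ι) (d : ι → Bool), 𝔼 x, 𝔼 y, ∑ τ ∈ S,
        (f τ (Function.update (maskBits x d) i false)
            * g τ (Function.update (maskBits y (notBits d)) i false)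
          - f τ (Function.update (maskBits x d) i true)
            * g τ (Function.update (maskBits y (notBits d)) i true))
      = ∑ τ ∈ S, (pinnedMean (f τ) d i false * pinnedMean (g τ) (notBits d) i false
        - pinnedMean (f τ) d i true * pinnedMean (g τ) (notBits d) i true) := by
    intro i d
    simp only [pinnedMean, Fintype.expect_mul_expect, Finset.expect_sum_comm,
      Finset.expect_sub_distrib]
  -- For fixed `d` the rectangle masses form a probability vector in `τ`, so the level-one bounds
  -- add up to twice an entropy.
  have weight : ∀ d : ι → Bool, ∑ i, ∑ τ, levelOneWeight (f τ) (g τ) d i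
      ≤ 2 * Real.log (Fintype.card T) := by
    intro d
    rw [Finset.sum_comm]
    refine (Finset.sum_le_sum fun τ _ =>
      sum_levelOneWeight_le (f0 τ) (f1 τ) (g0 τ) (g1 τ) d).trans ?_
    rw [← Finset.mul_sum]
    refine mul_le_mul_of_nonneg_left (sum_mul_neg_log_le_log_card _ (fun τ =>
      mul_nonneg (maskedMean_nonneg (f0 τ) _) (maskedMean_nonneg (g0 τ) _)) ?_) (by norm_num)
    exact sum_mul_expect_eq_one hfg _ _
  simp only [e]
  calc ∑ i, 𝔼 d, ∑ τ ∈ S, (pinnedMean (f τ) d i false * pinnedMean (g τ) (notBits d) i false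
        - pinnedMean (f τ) d i true * pinnedMean (g τ) (notBits d) i true)
      ≤ ∑ i, 𝔼 d : ι → Bool, (24 * ∑ τ, (levelOneWeight (f τ) (g τ) d i
          + levelOneWeight (f τ) (g τ) (flipBit i d) i) + 1 / 6) :=
        Finset.sum_le_sum fun i _ => Finset.expect_le_expect fun d _ =>
          sum_pinnedMean_sub_le f0 g0 hfg S d i
    -- Flipping bit `i` preserves the uniform law of `d`, so the two weights have equal averages.
    _ = ∑ i : ι, (48 * 𝔼 d : ι → Bool, ∑ τ, levelOneWeight (f τ) (g τ) d i + 1 / 6) := by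
        refine Finset.sum_congr rfl fun i _ => ?_
        simp only [Finset.sum_add_distrib, mul_add, Finset.expect_add_distrib,
          ← Finset.mul_expect]
        rw [expect_flipBit i (fun d => ∑ τ, levelOneWeight (f τ) (g τ) d i), Fintype.expect_const]
        ring
    _ = 48 * (𝔼 d : ι → Bool, ∑ i, ∑ τ, levelOneWeight (f τ) (g τ) d i) + Fintype.card ι / 6 := by
        rw [Finset.sum_add_distrib, ← Finset.mul_sum, Finset.expect_sum_comm]
        simp [div_eq_mul_inv]
    _ ≤ _ := by
        have h := Finset.expect_le_expect fun d (_ : d ∈ Finset.univ) => weight d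
        rw [Fintype.expect_const] at h
        linarith

end Disjointness

/-! ### Randomized protocols for set disjointness -/

section Expectation

variable {Ω ι : Type*} [MeasurableSpace Ω] {μ : MeasureTheory.Measure Ω} [Fintype ι]

theorem integrable_expect {f : ι → Ω → ℝ} (hf : ∀ i, MeasureTheory.Integrable (f i) μ) :
    MeasureTheory.Integrable (fun ω => 𝔼 i, f i ω) μ := by
  simp only [Fintype.expect_eq_sum_div_card]
  exact (MeasureTheory.integrable_finsetSum _ fun i _ => hf i).div_const _

theorem integral_expect {f : ι → Ω → ℝ} (hf : ∀ i, MeasureTheory.Integrable (f i) μ) :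
    ∫ ω, 𝔼 i, f i ω ∂μ = 𝔼 i, ∫ ω, f i ω ∂μ := by
  simp only [Fintype.expect_eq_sum_div_card]
  rw [MeasureTheory.integral_div, MeasureTheory.integral_finsetSum _ fun i _ => hf i]

end Expectation

section Protocol

variable {Ω ι T : Type*} [MeasurableSpace Ω] [Fintype ι] [DecidableEq ι] [Fintype T]

open Classical in
/-- The advantage estimate for a deterministic protocol with transcript `Q x y`, where `S` is the
set of accepting transcripts. -/
theorem deterministic_advantage_le (Q : (ι → Bool) → (ι → Bool) → T)
    (a b : T → (ι → Bool) → Prop) (hQ : ∀ x y τ, Q x y = τ ↔ a τ x ∧ b τ y) (S : Set T) :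
    ∑ i, 𝔼 d, 𝔼 x, 𝔼 y,
        ((if Q (Function.update (maskBits x d) i false)
            (Function.update (maskBits y (notBits d)) i false) ∈ S then (1 : ℝ) else 0)
          - if Q (Function.update (maskBits x d) i true)
            (Function.update (maskBits y (notBits d)) i true) ∈ S then (1 : ℝ) else 0)
      ≤ 96 * Real.log (Fintype.card T) + Fintype.card ι / 6 := by
  have h01 : ∀ p : Prop, (0 : ℝ) ≤ (if p then 1 else 0) ∧ (if p then (1 : ℝ) else 0) ≤ 1 := by
    intro p
    split_ifs <;> norm_num
  have hmul : ∀ τ x y, (if a τ x then (1 : ℝ) else 0) * (if b τ y then 1 else 0)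
      = if Q x y = τ then 1 else 0 := by
    intro τ x y
    rw [ite_zero_mul_ite_zero, one_mul]
    exact if_congr (hQ x y τ).symm rfl rfl
  have h := disjointness_advantage_le (f := fun τ x => if a τ x then (1 : ℝ) else 0)
    (g := fun τ y => if b τ y then (1 : ℝ) else 0) (fun _ _ => (h01 _).1) (fun _ _ => (h01 _).2)
    (fun _ _ => (h01 _).1) (fun _ _ => (h01 _).2) (by intro x y; simp [hmul]) S.toFinset
  simpa only [hmul, Finset.sum_sub_distrib, Finset.sum_ite_eq, Set.mem_toFinset] using h

/-- A randomized protocol that decides set disjointness with probability `2 / 3` on every input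
pair has exponentially many transcripts. -/
theorem card_le_log_card_transcripts (μ : MeasureTheory.Measure Ω)
    [MeasureTheory.IsProbabilityMeasure μ] (Q : Ω → (ι → Bool) → (ι → Bool) → T)
    (a b : Ω → T → (ι → Bool) → Prop) (hQ : ∀ ω x y τ, Q ω x y = τ ↔ a ω τ x ∧ b ω τ y)
    (S : Ω → Set T)
    (hS : ∀ x y, ∃ E : Set Ω, MeasurableSet E ∧ 2 / 3 ≤ μ E ∧
      ∀ ω ∈ E, (Q ω x y ∈ S ω ↔ ∀ i, ¬(x i = true ∧ y i = true))) :
    (Fintype.card ι : ℝ) ≤ 576 * Real.log (Fintype.card T) := by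
  classical
  choose E hE hμ hacc using hS
  set I : (ι → Bool) → (ι → Bool) → Ω → ℝ := fun x y => (E x y).indicator 1 with hI
  have hint : ∀ x y, MeasureTheory.Integrable (I x y) μ := fun x y =>
    (MeasureTheory.integrable_const (1 : ℝ)).indicator (hE x y)
  have hval : ∀ x y, 2 / 3 ≤ ∫ ω, I x y ω ∂μ := by
    intro x y
    rw [hI, MeasureTheory.integral_indicator_one (hE x y), MeasureTheory.measureReal_def]
    have h := ENNReal.toReal_mono (MeasureTheory.measure_ne_top μ _) (hμ x y)
    simpa using h
  -- Acceptance need not be measurable in `ω`. `V` is an integrable lower bound for the acceptance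
  -- difference, built from the measurable success events.
  let V : ι → (ι → Bool) → (ι → Bool) → (ι → Bool) → Ω → ℝ := fun i d x y ω =>
    I (Function.update (maskBits x d) i false)
        (Function.update (maskBits y (notBits d)) i false) ω
      + I (Function.update (maskBits x d) i true)
        (Function.update (maskBits y (notBits d)) i true) ω - 1
  have hV : ∀ i d x y, MeasureTheory.Integrable (V i d x y) μ := fun i d x y =>
    ((hint _ _).add (hint _ _)).sub (MeasureTheory.integrable_const 1)
  have hVval : ∀ i d x y, 1 / 3 ≤ ∫ ω, V i d x y ω ∂μ := by
    intro i d x y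
    simp only [V]
    rw [MeasureTheory.integral_sub (by exact (hint _ _).add (hint _ _))
      (MeasureTheory.integrable_const 1), MeasureTheory.integral_add (hint _ _) (hint _ _)]
    have h1 := hval (Function.update (maskBits x d) i false)
        (Function.update (maskBits y (notBits d)) i false)
    have h2 := hval (Function.update (maskBits x d) i true)
        (Function.update (maskBits y (notBits d)) i true)
    simp only [MeasureTheory.integral_const, MeasureTheory.probReal_univ, smul_eq_mul, mul_one]
    linarith
  have hpoint : ∀ ω, ∑ i, 𝔼 d, 𝔼 x, 𝔼 y, V i d x y ω
      ≤ 96 * Real.log (Fintype.card T) + Fintype.card ι / 6 := by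
    intro ω
    refine le_trans ?_ (deterministic_advantage_le (Q ω) (a ω) (b ω) (hQ ω) (S ω))
    refine Finset.sum_le_sum fun i _ => Finset.expect_le_expect fun d _ =>
      Finset.expect_le_expect fun x _ => Finset.expect_le_expect fun y _ => ?_
    have hd : ∀ j, ¬(Function.update (maskBits x d) i false j = true
        ∧ Function.update (maskBits y (notBits d)) i false j = true) := by
      intro j
      by_cases hj : j = i
      · subst hj; simp
      · simp only [Function.update_of_ne hj, maskBits, notBits]
        cases d j <;> simp
    have hn : ¬ ∀ j, ¬(Function.update (maskBits x d) i true j = true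
        ∧ Function.update (maskBits y (notBits d)) i true j = true) := by
      intro h
      exact h i (by simp)
    have h1 : I (Function.update (maskBits x d) i false)
          (Function.update (maskBits y (notBits d)) i false) ω
        ≤ if Q ω (Function.update (maskBits x d) i false)
            (Function.update (maskBits y (notBits d)) i false) ∈ S ω then (1 : ℝ) else 0 := by
      by_cases hω : ω ∈ E (Function.update (maskBits x d) i false)
          (Function.update (maskBits y (notBits d)) i false)
      · rw [if_pos ((hacc _ _ ω hω).2 hd)]
        simp [hI, hω]
      · simp only [hI, Set.indicator_of_notMem hω]
        split_ifs <;> norm_num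
    have h2 : I (Function.update (maskBits x d) i true)
          (Function.update (maskBits y (notBits d)) i true) ω
        ≤ 1 - if Q ω (Function.update (maskBits x d) i true)
            (Function.update (maskBits y (notBits d)) i true) ∈ S ω then (1 : ℝ) else 0 := by
      by_cases hω : ω ∈ E (Function.update (maskBits x d) i true)
          (Function.update (maskBits y (notBits d)) i true)
      · rw [if_neg (fun h => hn ((hacc _ _ ω hω).1 h))]
        simp [hI, hω]
      · simp only [hI, Set.indicator_of_notMem hω]
        split_ifs <;> norm_num
    simp only [V]
    linarith
  have hlow : (Fintype.card ι : ℝ) / 3 ≤ ∫ ω, ∑ i, 𝔼 d, 𝔼 x, 𝔼 y, V i d x y ω ∂μ := by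
    rw [MeasureTheory.integral_finsetSum _ fun i _ => integrable_expect fun d =>
      integrable_expect fun x => integrable_expect fun y => hV i d x y]
    have h : ∀ i, 1 / 3 ≤ ∫ ω, 𝔼 d, 𝔼 x, 𝔼 y, V i d x y ω ∂μ := by
      intro i
      rw [integral_expect fun d => integrable_expect fun x => integrable_expect fun y => hV i d x y]
      refine (Fintype.expect_const (ι := ι → Bool) (1 / 3 : ℝ)).symm.le.trans
        (Finset.expect_le_expect fun d _ => ?_)
      rw [integral_expect fun x => integrable_expect fun y => hV i d x y]
      refine (Fintype.expect_const (ι := ι → Bool) (1 / 3 : ℝ)).symm.le.trans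
        (Finset.expect_le_expect fun x _ => ?_)
      rw [integral_expect fun y => hV i d x y]
      exact (Fintype.expect_const (ι := ι → Bool) (1 / 3 : ℝ)).symm.le.trans
        (Finset.expect_le_expect fun y _ => hVval i d x y)
    calc (Fintype.card ι : ℝ) / 3 = ∑ _i : ι, (1 / 3 : ℝ) := by simp [div_eq_mul_inv]
      _ ≤ _ := Finset.sum_le_sum fun i _ => h i
  have hup : ∫ ω, ∑ i, 𝔼 d, 𝔼 x, 𝔼 y, V i d x y ω ∂μ
      ≤ 96 * Real.log (Fintype.card T) + Fintype.card ι / 6 := by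
    refine (MeasureTheory.integral_mono (MeasureTheory.integrable_finsetSum _ fun i _ =>
      integrable_expect fun d => integrable_expect fun x => integrable_expect fun y => hV i d x y)
      (MeasureTheory.integrable_const _) hpoint).trans ?_
    simp
  linarith

end Protocol

/-! ### Streaming algorithms as protocols -/

namespace StreamingAlgorithm

variable {Ω : Type*} {n d s : ℕ}

theorem readFrom_append (alg : StreamingAlgorithm Ω n d s) (ω : Ω) (p t : ℕ) (m : Fin s → Bool)
    (σ ρ : TurnstileStream n d) :
    alg.readFrom ω p t m (σ ++ ρ)
      = alg.readFrom ω p (t + σ.length) (alg.readFrom ω p t m σ) ρ := by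
  induction σ generalizing t m with
  | nil => rfl
  | cons u σ ih =>
    rw [List.cons_append, readFrom, ih, readFrom, List.length_cons, Nat.add_right_comm, add_assoc]

/-- The memory before pass number `p` according to a transcript, which lists for every pass the
memory in the middle and the memory at the end. -/
def startMemory (alg : StreamingAlgorithm Ω n d s) (ω : Ω) {r : ℕ}
    (τ : Fin r → (Fin s → Bool) × (Fin s → Bool)) : (p : ℕ) → p ≤ r → (Fin s → Bool)
  | 0, _ => alg.init ω
  | p + 1, h => (τ ⟨p, h⟩).2

/-- The transcript of `r` passes over the concatenation of two streams. -/
def transcript (alg : StreamingAlgorithm Ω n d s) (ω : Ω) (r : ℕ) (σ ρ : TurnstileStream n d) :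
    Fin r → (Fin s → Bool) × (Fin s → Bool) := fun p =>
  (alg.readFrom ω p 0 (alg.memoryAfter ω (σ ++ ρ) p) σ, alg.memoryAfter ω (σ ++ ρ) (p + 1))

theorem startMemory_transcript (alg : StreamingAlgorithm Ω n d s) (ω : Ω) (r : ℕ)
    (σ ρ : TurnstileStream n d) (p : ℕ) (h : p ≤ r) :
    alg.startMemory ω (alg.transcript ω r σ ρ) p h = alg.memoryAfter ω (σ ++ ρ) p := by
  cases p <;> rfl

/-- The transcript supplies the memory at the start of each half-pass, so consistency can be checked
separately on `σ` and on `ρ`; the second check involves `σ` only through its length. -/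
theorem transcript_eq_iff (alg : StreamingAlgorithm Ω n d s) (ω : Ω) (r : ℕ)
    (σ ρ : TurnstileStream n d) (τ : Fin r → (Fin s → Bool) × (Fin s → Bool)) :
    alg.transcript ω r σ ρ = τ ↔
      (∀ p : Fin r, (τ p).1 = alg.readFrom ω p 0 (alg.startMemory ω τ p p.2.le) σ) ∧
      ∀ p : Fin r, (τ p).2 = alg.endPass ω p (alg.readFrom ω p σ.length (τ p).1 ρ) := by
  constructor
  · rintro rfl
    refine ⟨fun p => ?_, fun p => ?_⟩
    · rw [startMemory_transcript]
      rfl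
    · simp only [transcript]
      rw [memoryAfter, readFrom_append, Nat.zero_add]
  · rintro ⟨h1, h2⟩
    have hstart : ∀ (p : ℕ) (h : p ≤ r),
        alg.startMemory ω τ p h = alg.memoryAfter ω (σ ++ ρ) p := by
      intro p
      induction p with
      | zero => intro h; rfl
      | succ p ih =>
        intro h
        rw [startMemory, h2, h1, ih (Nat.le_of_succ_le h), memoryAfter, readFrom_append,
          Nat.zero_add]
    funext p
    refine Prod.ext ?_ ?_
    · rw [h1, hstart]
      rfl
    · exact (hstart (p + 1) p.2).symm

end StreamingAlgorithm

/-! ### The two-means cost -/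

section TwoMeans

attribute [local instance] Matrix.frobeniusNormedAddCommGroup

theorem frobenius_norm_sq {m n : Type*} [Fintype m] [Fintype n] (A : Matrix m n ℝ) :
    ‖A‖ ^ 2 = ∑ i, ∑ j, A i j ^ 2 := by
  rw [Matrix.frobenius_norm_def, ← Real.sqrt_eq_rpow, Real.sq_sqrt (by positivity)]
  simp

theorem bddBelow_kMeansValues {n d : ℕ} (k : ℕ) (A : Matrix (Fin n) (Fin d) ℝ) :
    0 ∈ lowerBounds (kMeansValues k A) := by
  rintro v ⟨X, -, D, rfl⟩
  positivity

theorem mul_apply_of_row_eq_single {n d k : ℕ} {X : Matrix (Fin n) (Fin k) ℝ} {i : Fin n}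
    {c : Fin k} (h : X i = Pi.single c 1) (D : Matrix (Fin k) (Fin d) ℝ) (j : Fin d) :
    (X * D) i j = D c j := by
  rw [Matrix.mul_apply, Finset.sum_eq_single c]
  · simp [h]
  · intro b _ hb
    simp [h, hb]
  · simp

theorem optCost_two_eq_zero {n d : ℕ} {A : Matrix (Fin n) (Fin d) ℝ} (a b : Fin d → ℝ)
    (h : ∀ i, A i = a ∨ A i = b) : optCost 2 A = 0 := by
  classical
  refine le_antisymm (csInf_le ⟨0, bddBelow_kMeansValues 2 A⟩ ?_)
    (Real.sInf_nonneg fun v hv => bddBelow_kMeansValues 2 A hv)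
  refine ⟨Matrix.of fun i => Pi.single (if A i = a then (0 : Fin 2) else 1) 1,
    fun i => ⟨_, rfl⟩, Matrix.of ![a, b], ?_⟩
  have e : Matrix.of (fun i => Pi.single (if A i = a then (0 : Fin 2) else 1) (1 : ℝ))
      * Matrix.of ![a, b] = A := by
    ext i j
    rw [mul_apply_of_row_eq_single (c := if A i = a then (0 : Fin 2) else 1) rfl]
    by_cases hi : A i = a
    · simp [hi]
    · rw [if_neg hi, (h i).resolve_left hi]
      rfl
  rw [e, sub_self, norm_zero]
  norm_num

/-- For a common center `t`, `(t - u)² + (t - v)² ≥ (u - v)² / 2`. -/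
theorem half_le_of_eq_center {n d : ℕ} {A B : Matrix (Fin n) (Fin d) ℝ} {i j : Fin n} {l : Fin d}
    (hB : B i l = B j l) (hA : 1 ≤ A j l - A i l) : 1 / 2 ≤ ‖B - A‖ ^ 2 := by
  have hij : i ≠ j := by
    rintro rfl
    linarith
  rw [frobenius_norm_sq]
  have h1 : ∀ p, (B - A) p l ^ 2 ≤ ∑ q, (B - A) p q ^ 2 := fun p =>
    Finset.single_le_sum (f := fun q => (B - A) p q ^ 2) (fun q _ => sq_nonneg _)
      (Finset.mem_univ l)
  have h2 : ∑ p ∈ {i, j}, ∑ q, (B - A) p q ^ 2 ≤ ∑ p, ∑ q, (B - A) p q ^ 2 :=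
    Finset.sum_le_sum_of_subset_of_nonneg (Finset.subset_univ _) fun p _ _ =>
      Finset.sum_nonneg fun q _ => sq_nonneg _
  rw [Finset.sum_pair hij] at h2
  have h3 := h1 i
  have h4 := h1 j
  simp only [Matrix.sub_apply, ← hB] at h2 h3 h4 ⊢
  nlinarith [sq_nonneg (2 * B i l - A i l - A j l)]

/-- By pigeonhole two of the three separated rows share a center. The uniform bound `1 / 2` keeps
the infimum positive. -/
theorem optCost_two_pos {n d : ℕ} {A : Matrix (Fin n) (Fin d) ℝ} {i₀ i₁ i₂ : Fin n} {l : Fin d}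
    (h₁ : 1 ≤ A i₁ l - A i₀ l) (h₂ : 1 ≤ A i₂ l - A i₁ l) : 0 < optCost 2 A := by
  refine lt_of_lt_of_le (show (0 : ℝ) < 1 / 2 by norm_num) (le_csInf ?_ ?_)
  · exact ⟨_, Matrix.of fun _ => Pi.single 0 1, fun i => ⟨0, rfl⟩, 0, rfl⟩
  · rintro v ⟨X, hX, D, rfl⟩
    obtain ⟨c₀, e₀⟩ := hX i₀
    obtain ⟨c₁, e₁⟩ := hX i₁
    obtain ⟨c₂, e₂⟩ := hX i₂
    have f₀ := mul_apply_of_row_eq_single e₀ D l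
    have f₁ := mul_apply_of_row_eq_single e₁ D l
    have f₂ := mul_apply_of_row_eq_single e₂ D l
    have hc : c₀ = c₁ ∨ c₁ = c₂ ∨ c₀ = c₂ := by omega
    rcases hc with rfl | rfl | rfl
    · exact half_le_of_eq_center (f₀.trans f₁.symm) h₁
    · exact half_le_of_eq_center (f₁.trans f₂.symm) h₂
    · exact half_le_of_eq_center (f₀.trans f₂.symm) (by linarith)

end TwoMeans

/-! ### The hard streams -/

theorem streamMatrix_apply {n d : ℕ} (σ : TurnstileStream n d) (i : Fin n) (j : Fin d) :
    streamMatrix σ i j = (σ.map fun u => Matrix.single u.row u.col u.delta i j).sum := by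
  have h : ∀ A : Matrix (Fin n) (Fin d) ℝ,
      σ.foldl (fun A u => A + Matrix.single u.row u.col u.delta) A i j
        = A i j + (σ.map fun u => Matrix.single u.row u.col u.delta i j).sum := by
    induction σ with
    | nil => simp
    | cons u σ ih => intro A; simp [ih, add_assoc]
  rw [streamMatrix, h]
  simp

/-- The updates that add the bits of `x` to the rows from number `2` on. -/
def bitStream {m : ℕ} (x : Fin m → Bool) : TurnstileStream (m + 2) 1 :=
  List.ofFn fun i => ⟨i.succ.succ, 0, if x i then 1 else 0⟩

/-- The first half of the stream: row number `1` becomes `1`, and the bits of `x` are added. -/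
def firstHalf {m : ℕ} (x : Fin m → Bool) : TurnstileStream (m + 2) 1 :=
  ⟨1, 0, 1⟩ :: bitStream x

/-- Zero bits also produce updates, so the position where the second half starts does not depend on
`x`, as the rectangle property requires. -/
theorem length_firstHalf {m : ℕ} (x : Fin m → Bool) : (firstHalf x).length = m + 1 := by
  simp [firstHalf, bitStream]

theorem firstHalf_append_mem_unitStreams {m : ℕ} (x y : Fin m → Bool) :
    firstHalf x ++ bitStream y ∈ unitStreams (m + 2) 1 := by
  have hb : ∀ z : Fin m → Bool, ∀ u ∈ bitStream z, u.delta = -1 ∨ u.delta = 0 ∨ u.delta = 1 := by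
    intro z u hu
    obtain ⟨i, rfl⟩ := (List.mem_ofFn' _ _).1 hu
    cases h : z i <;> simp [h]
  refine ⟨?_, fun u hu => ?_⟩
  · rw [List.length_append, length_firstHalf]
    simp only [bitStream, List.length_ofFn]
    omega
  · rcases List.mem_append.1 hu with hu | hu
    · rcases List.mem_cons.1 hu with rfl | hu
      · simp
      · exact hb x u hu
    · exact hb y u hu

theorem sum_map_bitStream {m : ℕ} (x : Fin m → Bool) (i : Fin (m + 2)) :
    ((bitStream x).map fun u => Matrix.single u.row u.col u.delta i 0).sum
      = Fin.cases 0 (Fin.cases 0 fun j => if x j then (1 : ℝ) else 0) i := by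
  rw [bitStream, List.map_ofFn, List.sum_ofFn]
  refine Fin.cases ?_ (Fin.cases ?_ fun j => ?_) i
  · exact Finset.sum_eq_zero fun j _ => by simp [Matrix.single_apply, Fin.succ_ne_zero]
  · refine Finset.sum_eq_zero fun j _ => ?_
    simp only [Function.comp, Matrix.single_apply, Fin.succ_inj]
    simp [Fin.succ_ne_zero]
  · simp [Matrix.single_apply, Fin.succ_inj]

theorem streamMatrix_hard {m : ℕ} (x y : Fin m → Bool) (i : Fin (m + 2)) :
    streamMatrix (firstHalf x ++ bitStream y) i 0
      = Fin.cases 0 (Fin.cases 1 fun j =>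
          (if x j then (1 : ℝ) else 0) + if y j then 1 else 0) i := by
  rw [streamMatrix_apply, firstHalf, List.map_append, List.sum_append, List.map_cons,
    List.sum_cons, sum_map_bitStream, sum_map_bitStream]
  refine Fin.cases ?_ (Fin.cases ?_ fun j => ?_) i
  · simp
  · simp only [Fin.cases_zero, Fin.cases_succ]
    simp
  · have : (1 : Fin (m + 2)) ≠ j.succ.succ := by
      rw [← Fin.succ_zero_eq_one, Ne, Fin.succ_inj]
      exact (Fin.succ_ne_zero j).symm
    simp [this]

theorem optCost_hard_of_disjoint {m : ℕ} {x y : Fin m → Bool}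
    (h : ∀ i, ¬(x i = true ∧ y i = true)) :
    optCost 2 (streamMatrix (firstHalf x ++ bitStream y)) = 0 := by
  refine optCost_two_eq_zero (fun _ => 0) (fun _ => 1) fun i => ?_
  have key : streamMatrix (firstHalf x ++ bitStream y) i 0 = 0 ∨
      streamMatrix (firstHalf x ++ bitStream y) i 0 = 1 := by
    rw [streamMatrix_hard]
    refine Fin.cases ?_ (Fin.cases ?_ fun j => ?_) i
    · simp
    · exact Or.inr rfl
    · have := h j
      cases hx : x j <;> cases hy : y j <;> simp_all
  exact key.imp (fun e => funext fun j => by rw [Subsingleton.elim j 0, e])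
    (fun e => funext fun j => by rw [Subsingleton.elim j 0, e])

theorem optCost_hard_of_common {m : ℕ} {x y : Fin m → Bool} {i : Fin m}
    (hx : x i = true) (hy : y i = true) :
    0 < optCost 2 (streamMatrix (firstHalf x ++ bitStream y)) := by
  refine optCost_two_pos (i₀ := 0) (i₁ := Fin.succ 0) (i₂ := i.succ.succ) (l := 0) ?_ ?_ <;>
    simp only [streamMatrix_hard, Fin.cases_zero, Fin.cases_succ, hx, hy] <;> norm_num

theorem card_le_passes_mul_space {Ω : Type*} [MeasurableSpace Ω] (μ : MeasureTheory.Measure Ω)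
    [MeasureTheory.IsProbabilityMeasure μ] {m s : ℕ} (r : ℕ)
    (alg : StreamingAlgorithm Ω (m + 2) 1 s) {T : Set (TurnstileStream (m + 2) 1)}
    (hT : unitStreams (m + 2) 1 ⊆ T) (h : alg.EstimatesCost μ 2 r T) :
    (m : ℝ) ≤ 1152 * (r * s) := by
  have key := card_le_log_card_transcripts (ι := Fin m) μ
    (fun ω x y => alg.transcript ω r (firstHalf x) (bitStream y))
    (fun ω τ x => ∀ p : Fin r,
      (τ p).1 = alg.readFrom ω p 0 (alg.startMemory ω τ p p.2.le) (firstHalf x))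
    (fun ω τ y => ∀ p : Fin r,
      (τ p).2 = alg.endPass ω p (alg.readFrom ω p (m + 1) (τ p).1 (bitStream y)))
    (by
      intro ω x y τ
      rw [StreamingAlgorithm.transcript_eq_iff, length_firstHalf])
    -- On success, `0 ≤ c ≤ OPT ≤ 2c` makes the output vanish exactly when the cost does.
    (fun ω => {τ | alg.output ω (alg.startMemory ω τ r le_rfl) = 0})
    (by
      intro x y
      obtain ⟨E, hE, hμ, hrun⟩ := h _ (hT (firstHalf_append_mem_unitStreams x y))
      refine ⟨E, hE, hμ, fun ω hω => ?_⟩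
      rw [Set.mem_ofPred_eq, StreamingAlgorithm.startMemory_transcript]
      obtain ⟨h0, h1, h2⟩ := hrun ω hω
      rw [StreamingAlgorithm.run] at h0 h1 h2
      constructor
      · rintro hz i ⟨hx, hy⟩
        have := optCost_hard_of_common hx hy
        linarith
      · intro hd
        rw [optCost_hard_of_disjoint hd] at h1
        exact le_antisymm h1 h0)
  have hcard : Real.log (Fintype.card (Fin r → (Fin s → Bool) × (Fin s → Bool)))
      = 2 * Real.log 2 * (r * s) := by
    simp only [Fintype.card_pi, Fintype.card_prod, Fintype.card_bool, Finset.prod_const,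
      Finset.card_univ, Fintype.card_fin]
    push_cast
    rw [Real.log_pow, ← pow_add, Real.log_pow]
    push_cast
    ring
  rw [hcard, Fintype.card_fin] at key
  have h2 : Real.log 2 ≤ 1 := by linarith [Real.log_two_lt_d9]
  have h3 : Real.log 2 * ((r : ℝ) * s) ≤ 1 * (r * s) :=
    mul_le_mul_of_nonneg_right h2 (by positivity)
  linarith

theorem mainTheorem9 (r : ℕ) :
    ∃ c : ℝ, 0 < c ∧ ∃ N : ℕ, ∀ n : ℕ, N ≤ n →
      ∀ (Ω : Type*) [MeasurableSpace Ω] (μ : MeasureTheory.Measure Ω)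
        [MeasureTheory.IsProbabilityMeasure μ]
        (s : ℕ) (alg : StreamingAlgorithm Ω n 1 s)
        (T : Set (TurnstileStream n 1)), unitStreams n 1 ⊆ T →
        alg.EstimatesCost μ 2 r T →
        c * (n : ℝ) ≤ (s : ℝ) := by
  -- For `n ≥ 4`, `n = m + 2 ≤ 2 * m`, which doubles `1152`; `r + 1` keeps the denominator positive
  -- at `r = 0`.
  refine ⟨1 / (2304 * (r + 1)), by positivity, 4, ?_⟩
  intro n hn Ω _ μ _ s alg T hT h
  obtain ⟨m, rfl⟩ : ∃ m, n = m + 2 := ⟨n - 2, by omega⟩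
  have hm : (2 : ℝ) ≤ m := by exact_mod_cast (show 2 ≤ m by omega)
  have key := card_le_passes_mul_space μ r alg hT h
  rw [div_mul_eq_mul_div, div_le_iff₀ (by positivity)]
  push_cast
  have hs : (0 : ℝ) ≤ s := s.cast_nonneg
  linarith
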